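/- **Theorem 3 (MIS almost independent of $r$).** A hypergraph $H=(V,E)$ consists of a finite set $V$ of nodes and a set $E$ of nonempty subsets of $V$ (hyperedges); a set $S\subseteq V$ is independent if no hyperedge is fully contained in $S$, and a maximal independent set (MIS) is an inclusion-wise maximal independent set. In the deterministic LOCAL model, the nodes have distinct identifiers from $\{1,\dots,n^c\}$ for a constant $c\ge 1$, where $n=|V|$; every node initially knows its identifier, its degree, $n$, $\Delta$ and $r$; in each synchronous round it exchanges messages of arbitrary size with the nodes with which it shares a hyperedge and performs an arbitrary local computation; and at the end every node outputs whether it belongs to the set. For every integer constant $c\ge 1$ there are a constant $C$ and a deterministic LOCAL algorithm that, for all $n,\Delta,r$, on every $n$-node hypergraph in which every node lies in at most $\Delta$ hyperedges and every hyperedge has at most $r$ nodes, and for every assignment of distinct identifiers from $\{1,\dots,n^c\}$, computes an MIS within $$2^{C\,\Delta\log_2\Delta}\cdot\log^* r + C\cdot\log^* n$$ rounds, that is, in $2^{O(\Delta\log\Delta)}\log^* r+O(\log^* n)$ rounds. Here $\log^* x$ is the number of times $\log_2$ has to be applied to $x$ until the result is at most $1$, and $0\cdot\log_2 0=0$. 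-/

import Mathlib

universe u

/-- `log* x`: the number of times the binary logarithm has to be applied to `x` until the result is
at most `1`. -/
noncomputable def logStar (x : ℕ) : ℕ :=
  sInf {k : ℕ | (Real.logb 2)^[k] (x : ℝ) ≤ 1}

/-- Iterating the binary logarithm does reach a value `≤ 1`, so the infimum defining `logStar` is
attained. -/
theorem logStar_spec (x : ℕ) : (Real.logb 2)^[logStar x] (x : ℝ) ≤ 1 := by
  have key : ∀ m : ℕ, ∀ y : ℝ, y ≤ m + 1 → ∃ k : ℕ, (Real.logb 2)^[k] y ≤ 1 := by
    intro m
    induction m with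
    | zero => intro y hy; exact ⟨0, by simpa using hy⟩
    | succ m ih =>
      intro y hy
      by_cases h1 : y ≤ 1
      · exact ⟨0, by simpa using h1⟩
      · have hy0 : 0 < y := by linarith
        have hlog : Real.logb 2 y ≤ m + 1 := by
          rw [Real.logb_le_iff_le_rpow (by norm_num) hy0]
          have hb : (m : ℝ) + 2 ≤ (2 : ℝ) ^ (m + 1 : ℕ) := by
            exact_mod_cast Nat.lt_two_pow_self (n := m + 1)
          have hc : (2 : ℝ) ^ ((m : ℝ) + 1) = (2 : ℝ) ^ (m + 1 : ℕ) := by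
            rw [← Real.rpow_natCast]; push_cast; rfl
          rw [hc]
          push_cast at hy
          linarith
        obtain ⟨k, hk⟩ := ih _ hlog
        exact ⟨k + 1, by simpa using hk⟩
  exact Nat.sInf_mem (s := {k : ℕ | (Real.logb 2)^[k] (x : ℝ) ≤ 1}) (key x x (by linarith))

namespace Hypergraph

variable {V : Type u}

/-- The degree of a node: the number of hyperedges that contain it. -/
noncomputable def degree (H : Hypergraph V) (v : V) : ℕ :=
  {e | e ∈ H.edgeSet ∧ v ∈ e}.ncard

/-- An independent set: a set of nodes that fully contains no hyperedge. -/
def IsIndependent (H : Hypergraph V) (S : Set V) : Prop :=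
  S ⊆ H.vertexSet ∧ ∀ e ∈ H.edgeSet, ¬ e ⊆ S

/-- A maximal independent set: an inclusion-wise maximal set among the independent sets. -/
def IsMIS (H : Hypergraph V) (S : Set V) : Prop :=
  Maximal H.IsIndependent S

end Hypergraph

/-- A deterministic synchronous message passing algorithm on hypergraphs whose nodes compute an
output of type `Out`. Local computations and messages are unrestricted. -/
structure LocalAlgorithm (Out : Type) where
  /-- The local states of a node. -/
  State : Type
  /-- The messages. -/
  Msg : Type
  /-- `init n Δ r d i` is the initial state of a node of degree `d` with identifier `i`, where the
  number `n` of nodes, the maximum degree `Δ` and the rank `r` are known to all nodes. -/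
  init : (n Δ r d i : ℕ) → State
  /-- The message that a node in the given state sends to all its neighbors. (It may carry
  the identifiers of the intended recipients together with what is meant for each of them.) -/
  send : State → Msg
  /-- The new state of a node, computed from its state and the messages received: for every incident
  hyperedge, the set of the messages of the other nodes of that hyperedge. (Messages may
  carry the identifier of the sender, so that nothing is lost in taking sets.) -/
  receive : State → Set (Set Msg) → State
  /-- The output of a node that stops in the given state. -/
  output : State → Out

namespace LocalAlgorithm

variable {Out : Type} {V : Type u}

/-- `A.stateAfter n Δ r H ident t v` is the state of node `v` after `t` synchronous communication
rounds of the algorithm `A` on the hypergraph `H` with node identifiers `ident`, when the nodes are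
told the parameters `n`, `Δ`, `r`. -/
noncomputable def stateAfter (A : LocalAlgorithm Out) (n Δ r : ℕ) (H : Hypergraph V)
    (ident : V → ℕ) : ℕ → V → A.State
  | 0 => fun v => A.init n Δ r (H.degree v) (ident v)
  | t + 1 => fun v =>
      A.receive (A.stateAfter n Δ r H ident t v)
        {M | ∃ e ∈ H.edgeSet, v ∈ e ∧
          M = (fun w => A.send (A.stateAfter n Δ r H ident t w)) '' (e \ {v})}

/-- `A` solves the hypergraph MIS problem in the LOCAL model with identifiers from `{1, …, n ^ c}`,
where all nodes stop after `T n Δ r` rounds: on each finite hypergraph with `n` nodes, maximum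
degree at most `Δ` and rank at most `r`, and for each assignment of distinct identifiers, the nodes
that output `true` form an MIS. -/
def SolvesMIS (A : LocalAlgorithm Bool) (c : ℕ) (T : ℕ → ℕ → ℕ → ℕ) : Prop :=
  ∀ (n Δ r : ℕ) (V : Type u) (H : Hypergraph V) (ident : V → ℕ),
    H.vertexSet.Finite → H.vertexSet.ncard = n →
    (∀ e ∈ H.edgeSet, e.Nonempty) →
    (∀ v ∈ H.vertexSet, H.degree v ≤ Δ) →
    (∀ e ∈ H.edgeSet, e.ncard ≤ r) →
    Set.InjOn ident H.vertexSet →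
    (∀ v ∈ H.vertexSet, 1 ≤ ident v ∧ ident v ≤ n ^ c) →
    H.IsMIS {v | v ∈ H.vertexSet ∧ A.output (A.stateAfter n Δ r H ident (T n Δ r) v) = true}

end LocalAlgorithm

/-! A set whose complement hits every edge is an MIS once each node of that complement has a private
edge, one that it alone hits (`Hypergraph.isMIS_of_private`). So the task is to find a hitting set
all of whose nodes have private edges.

Such a set is built by recursion on the degree (`minHit_spec`). Each edge selects one node, and the
selected nodes form a hitting set. Draw arcs from a node to the other nodes selected by its edges:
the out-degree is at most the degree, whatever the size of the edges. Linial's color reduction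
(`exists_recolor`) therefore yields poly(Δ) colors such that a selected node has a color of its own
in the edge that selects it. Now treat the color classes in turn. Nodes of the class with a private
edge, among the edges missed by the other classes, stay. For any other node v of the class, the edge
that selected v must be hit by another class, since otherwise it would be private to v. Hence v has
smaller degree in the edges still to be hit, and the recursion thins out these nodes.

The recursion has depth Δ and branches over poly(Δ) colors, so it costs poly(Δ)^Δ · log* m rounds
when started from a coloring with m colors. The rank enters only through m = poly(Δr); that coloring
comes once from the identifiers, in O(log* n) rounds.

All objects are defined globally, as functions of the edge set. The `NodeLocal` lemmas bound the
radius on which they depend, and `fullInformation_stateAfter` shows that flooding supplies a view of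
that radius. -/

/-! ### Iterated powers of two and `logStar` -/

/-- The tower `2 ^ 2 ^ ⋯ ^ 2` of height `k`. -/
def tower : ℕ → ℕ
  | 0 => 1
  | k + 1 => 2 ^ tower k

theorem one_le_tower (k : ℕ) : 1 ≤ tower k := by
  cases k with
  | zero => exact le_rfl
  | succ k => exact Nat.one_le_two_pow

theorem tower_lt_tower_succ (k : ℕ) : tower k < tower (k + 1) := Nat.lt_two_pow_self

theorem tower_mono : Monotone tower := monotone_nat_of_le_succ fun k => (tower_lt_tower_succ k).le

/-- As long as the iterates exceed 1, each logarithm can be inverted by exponentiating. -/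
theorem le_tower_of_iterate_logb_le (k : ℕ) :
    ∀ y : ℝ, (Real.logb 2)^[k] y ≤ 1 → (∀ j < k, 1 < (Real.logb 2)^[j] y) → y ≤ tower k := by
  induction k with
  | zero => intro y hy _; simpa [tower] using hy
  | succ k ih =>
    intro y hy hj
    have h1 : 1 < y := by simpa using hj 0 (Nat.succ_pos k)
    have h2 : Real.logb 2 y ≤ tower k :=
      ih _ (by simpa using hy) fun j hjk => by simpa using hj (j + 1) (by omega)
    rw [Real.logb_le_iff_le_rpow (by norm_num) (by linarith), Real.rpow_natCast] at h2
    simpa [tower] using h2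

theorem exists_iterate_logb_le (k : ℕ) :
    ∀ y : ℝ, y ≤ tower k → ∃ j ≤ k, (Real.logb 2)^[j] y ≤ 1 := by
  induction k with
  | zero => intro y hy; exact ⟨0, le_rfl, by simpa [tower] using hy⟩
  | succ k ih =>
    intro y hy
    by_cases h1 : y ≤ 1
    · exact ⟨0, Nat.zero_le _, by simpa using h1⟩
    · have h2 : Real.logb 2 y ≤ tower k := by
        rw [Real.logb_le_iff_le_rpow (by norm_num) (by linarith), Real.rpow_natCast]
        simpa [tower] using hy
      obtain ⟨j, hj, h⟩ := ih _ h2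
      exact ⟨j + 1, by omega, by simpa using h⟩

theorem le_tower_logStar (x : ℕ) : x ≤ tower (logStar x) := by
  have := le_tower_of_iterate_logb_le (logStar x) x (logStar_spec x) fun j hj => by
    by_contra h
    exact Nat.notMem_of_lt_sInf hj (not_lt.1 h)
  exact_mod_cast this

/-- This adjunction replaces iterated real logarithms by inequalities between natural numbers; the
later estimates of `logStar` rest on it. -/
theorem logStar_le_iff {x k : ℕ} : logStar x ≤ k ↔ x ≤ tower k := by
  refine ⟨fun h => (le_tower_logStar x).trans (tower_mono h), fun h => ?_⟩
  obtain ⟨j, hj, h'⟩ := exists_iterate_logb_le k x (by exact_mod_cast h)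
  exact (Nat.sInf_le (s := {k : ℕ | (Real.logb 2)^[k] (x : ℝ) ≤ 1}) h').trans hj

theorem logStar_mono : Monotone logStar := fun _ y h =>
  logStar_le_iff.2 (h.trans (le_tower_logStar y))

theorem one_le_logStar {x : ℕ} (hx : 2 ≤ x) : 1 ≤ logStar x := by
  by_contra h
  have : x ≤ tower 0 := logStar_le_iff.1 (by omega)
  simp [tower] at this
  omega

theorem two_pow_mul_tower_le (c k : ℕ) : 2 ^ c * tower k ≤ tower (k + c) := by
  induction c with
  | zero => simp
  | succ c ih =>
    calc 2 ^ (c + 1) * tower k = 2 * (2 ^ c * tower k) := by ring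
      _ ≤ 2 * tower (k + c) := by gcongr
      _ ≤ 2 ^ tower (k + c) := by
        have h : ∀ z : ℕ, 1 ≤ z → 2 * z ≤ 2 ^ z := by
          intro z hz
          obtain ⟨w, rfl⟩ := Nat.exists_eq_add_of_le' hz
          have := Nat.lt_two_pow_self (n := w)
          rw [pow_succ]
          omega
        exact h _ (one_le_tower _)

theorem logStar_two_pow_mul_le (c x : ℕ) : logStar (2 ^ c * x) ≤ logStar x + c :=
  logStar_le_iff.2 ((Nat.mul_le_mul_left _ (le_tower_logStar x)).trans (two_pow_mul_tower_le _ _))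

/-- One level down the tower the power becomes a factor c ≤ 2 ^ c, and each doubling costs at most
one level. -/
theorem logStar_pow_le (c x : ℕ) : logStar (x ^ c) ≤ logStar x + c := by
  refine logStar_le_iff.2 ((Nat.pow_le_pow_left (le_tower_logStar x) c).trans ?_)
  cases logStar x with
  | zero => simpa [tower] using one_le_tower _
  | succ k =>
    calc tower (k + 1) ^ c = 2 ^ (tower k * c) := by rw [tower, pow_mul]
      _ ≤ 2 ^ (2 ^ c * tower k) := by
        refine Nat.pow_le_pow_right (by norm_num) ?_
        rw [mul_comm]
        exact Nat.mul_le_mul_right _ Nat.lt_two_pow_self.le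
      _ ≤ 2 ^ tower (k + c) := Nat.pow_le_pow_right (by norm_num) (two_pow_mul_tower_le _ _)
      _ = tower (k + 1 + c) := by rw [show k + 1 + c = k + c + 1 by ring, tower]

theorem logStar_two_pow_le (x : ℕ) : logStar (2 ^ x) ≤ logStar x + 1 :=
  logStar_le_iff.2 (Nat.pow_le_pow_right (by norm_num) (le_tower_logStar x))

/-! ### Color reduction in directed graphs of bounded out-degree -/

/-- The number of colors after one color reduction step in a graph of out-degree `d` that starts
from `m` colors. -/
def numColors (d m : ℕ) : ℕ := (2 * ((Nat.log 2 m + 1) * d + 1)) ^ 2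

/-- The polynomial whose coefficients are the first `k` binary digits of `x`. -/
noncomputable def bitPoly (R : Type*) [CommRing R] (k x : ℕ) : Polynomial R :=
  ∑ i ∈ Finset.range k, if x.testBit i then Polynomial.X ^ i else 0

theorem bitPoly_coeff (R : Type*) [CommRing R] {k i : ℕ} (x : ℕ) (hi : i < k) :
    (bitPoly R k x).coeff i = if x.testBit i then 1 else 0 := by
  rw [bitPoly, Polynomial.finsetSum_coeff, Finset.sum_eq_single i]
  · split_ifs <;> simp
  · intro j _ hj
    split_ifs
    · rw [Polynomial.coeff_X_pow, if_neg hj.symm]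
    · simp
  · intro h; exact absurd (Finset.mem_range.2 hi) h

theorem bitPoly_natDegree_le (R : Type*) [CommRing R] (k x : ℕ) :
    (bitPoly R k x).natDegree ≤ k := by
  refine Polynomial.natDegree_sum_le_of_forall_le _ _ fun i hi => ?_
  split_ifs
  · exact (Polynomial.natDegree_X_pow_le i).trans (Finset.mem_range.1 hi).le
  · simp

theorem bitPoly_ne {R : Type*} [CommRing R] [Nontrivial R] {k x y : ℕ} (hx : x < 2 ^ k)
    (hy : y < 2 ^ k) (hxy : x ≠ y) : bitPoly R k x ≠ bitPoly R k y := by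
  intro h
  refine hxy (Nat.eq_of_testBit_eq fun i => ?_)
  by_cases hi : i < k
  · have := congrArg (fun p => p.coeff i) h
    simp only [bitPoly_coeff R _ hi] at this
    cases hxb : x.testBit i <;> cases hyb : y.testBit i <;> simp_all
  · have hk : 2 ^ k ≤ 2 ^ i := Nat.pow_le_pow_right (by norm_num) (not_lt.1 hi)
    rw [Nat.testBit_eq_false_of_lt (hx.trans_le hk), Nat.testBit_eq_false_of_lt (hy.trans_le hk)]

/-- A point at which a given polynomial differs from `d` others. -/
theorem exists_eval_ne {q k d m x : ℕ} [Fact q.Prime] (hq : k * d < q) (hm : m ≤ 2 ^ k)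
    (hx : x < m) {S : Set ℕ} (hS : S.Finite) (hd : S.ncard ≤ d) (hSm : ∀ y ∈ S, y < m)
    (hxS : x ∉ S) :
    ∃ a : ZMod q, ∀ y ∈ S, (bitPoly (ZMod q) k y).eval a ≠ (bitPoly (ZMod q) k x).eval a := by
  classical
  let bad : Finset (ZMod q) :=
    hS.toFinset.biUnion fun y => (bitPoly (ZMod q) k y - bitPoly (ZMod q) k x).roots.toFinset
  have hcard : bad.card < Fintype.card (ZMod q) := by
    rw [ZMod.card]
    refine lt_of_le_of_lt (Finset.card_biUnion_le_card_mul _ _ k fun y _ => ?_) ?_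
    · refine (Multiset.toFinset_card_le _).trans ((Polynomial.card_roots' _).trans ?_)
      exact (Polynomial.natDegree_sub_le _ _).trans
        (max_le (bitPoly_natDegree_le _ _ _) (bitPoly_natDegree_le _ _ _))
    · rw [← Set.ncard_eq_toFinset_card S hS, mul_comm]
      exact (Nat.mul_le_mul_left k hd).trans_lt hq
  obtain ⟨a, ha⟩ : ∃ a, a ∉ bad := by
    by_contra! h
    rw [Finset.eq_univ_iff_forall.2 h, Finset.card_univ] at hcard
    exact lt_irrefl _ hcard
  refine ⟨a, fun y hy h => ha ?_⟩
  have hne : bitPoly (ZMod q) k y - bitPoly (ZMod q) k x ≠ 0 :=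
    sub_ne_zero.2 (bitPoly_ne ((hSm y hy).trans_le hm) (hx.trans_le hm)
      fun h => hxS (h ▸ hy))
  simp only [bad, Finset.mem_biUnion, Set.Finite.mem_toFinset, Multiset.mem_toFinset]
  exact ⟨y, hy, (Polynomial.mem_roots hne).2 (by simp [Polynomial.IsRoot, h])⟩

/-- `IsAdmissible d m x S`: a node of color `x < m` with at most `d` out-neighbors may see the set
`S` of colors on them. -/
def IsAdmissible (d m x : ℕ) (S : Set ℕ) : Prop :=
  x < m ∧ S.Finite ∧ S.ncard ≤ d ∧ (∀ y ∈ S, y < m) ∧ x ∉ S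

/-- Colors become polynomials over a field with q > k * d elements. Two distinct ones agree in at
most k points, so a node finds a point where its polynomial differs from those of its out-neighbors;
point and value form the new color. Equal new colors at the two ends of an arc would contradict the
choice made at its tail. -/
theorem exists_recolor (d m : ℕ) :
    ∃ f : ℕ → Set ℕ → ℕ, (∀ x S, f x S < numColors d m) ∧
      ∀ x y S T, IsAdmissible d m x S → IsAdmissible d m y T → y ∈ S → f x S ≠ f y T := by
  classical
  set k := Nat.log 2 m + 1 with hk
  have hm : m ≤ 2 ^ k := (Nat.lt_pow_succ_log_self (by norm_num) m).le
  -- Bertrand's postulate keeps q * q within `numColors d m`.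
  obtain ⟨q, hqp, hq1, hq2⟩ := Nat.exists_prime_lt_and_le_two_mul (k * d + 1) (by omega)
  have : Fact q.Prime := ⟨hqp⟩
  have hqn : q * q ≤ numColors d m := by
    rw [numColors, sq]
    exact Nat.mul_le_mul hq2 hq2
  have hq0 : 0 < q := hqp.pos
  let good (x : ℕ) (S : Set ℕ) (a : ZMod q) : Prop :=
    ∀ y ∈ S, (bitPoly (ZMod q) k y).eval a ≠ (bitPoly (ZMod q) k x).eval a
  -- The pair (point, value) is written in base q and recovered below by division and remainder. The
  -- default 0 makes the bound on the colors hold for all inputs.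
  let f : ℕ → Set ℕ → ℕ := fun x S =>
    if h : ∃ a, good x S a then h.choose.val * q + ((bitPoly (ZMod q) k x).eval h.choose).val
    else 0
  have key : ∀ x S, IsAdmissible d m x S → ∃ a, good x S a ∧
      f x S = a.val * q + ((bitPoly (ZMod q) k x).eval a).val := by
    rintro x S ⟨hx, hS, hd, hSm, hxS⟩
    have h : ∃ a, good x S a := exists_eval_ne (by omega) hm hx hS hd hSm hxS
    exact ⟨h.choose, h.choose_spec, by simp only [f, dif_pos h]⟩
  refine ⟨f, fun x S => ?_, fun x y S T hx hy hyS h => ?_⟩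
  · refine lt_of_lt_of_le ?_ hqn
    by_cases h : ∃ a, good x S a
    · simp only [f, dif_pos h]
      have h1 := ZMod.val_lt h.choose
      have h2 := ZMod.val_lt ((bitPoly (ZMod q) k x).eval h.choose)
      nlinarith
    · simp only [f, dif_neg h]
      positivity
  · obtain ⟨a, ha, hfa⟩ := key x S hx
    obtain ⟨b, -, hfb⟩ := key y T hy
    rw [hfa, hfb] at h
    have hdiv := congrArg (· / q) h
    have hmod := congrArg (· % q) h
    simp only [Nat.mul_add_mod_self_right, Nat.mod_eq_of_lt (ZMod.val_lt _)] at hmod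
    rw [mul_comm a.val, mul_comm b.val] at hdiv
    simp only [Nat.mul_add_div hq0, Nat.div_eq_of_lt (ZMod.val_lt _), add_zero] at hdiv
    have hab : a = b := ZMod.val_injective q hdiv
    subst hab
    exact ha y hyS (ZMod.val_injective q hmod).symm

/-- The color reduction step: the new color of a node, from its color and the set of the colors of
its out-neighbors. -/
noncomputable def recolor (d m : ℕ) : ℕ → Set ℕ → ℕ := (exists_recolor d m).choose

theorem recolor_lt (d m x : ℕ) (S : Set ℕ) : recolor d m x S < numColors d m :=
  (exists_recolor d m).choose_spec.1 x S

theorem recolor_ne {d m x y : ℕ} {S T : Set ℕ} (hx : IsAdmissible d m x S)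
    (hy : IsAdmissible d m y T) (h : y ∈ S) : recolor d m x S ≠ recolor d m y T :=
  (exists_recolor d m).choose_spec.2 x y S T hx hy h

/-- The coloring after a number of color reduction steps, starting from a coloring `φ` with `m`
colors. -/
noncomputable def reduceColors (d m : ℕ) (out : ℕ → Set ℕ) (φ : ℕ → ℕ) : ℕ → ℕ → ℕ
  | 0 => φ
  | s + 1 => fun v => recolor d ((numColors d)^[s] m) (reduceColors d m out φ s v)
      (reduceColors d m out φ s '' out v)

theorem reduceColors_spec {d m : ℕ} {out : ℕ → Set ℕ} {φ : ℕ → ℕ} {X : Set ℕ}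
    (hsub : ∀ v ∈ X, out v ⊆ X) (hfin : ∀ v ∈ X, (out v).Finite)
    (hcard : ∀ v ∈ X, (out v).ncard ≤ d) (hm : ∀ v ∈ X, φ v < m)
    (hφ : ∀ v ∈ X, ∀ w ∈ out v, φ v ≠ φ w) (s : ℕ) :
    (∀ v ∈ X, reduceColors d m out φ s v < (numColors d)^[s] m) ∧
      ∀ v ∈ X, ∀ w ∈ out v, reduceColors d m out φ s v ≠ reduceColors d m out φ s w := by
  induction s with
  | zero => exact ⟨hm, hφ⟩
  | succ s ih =>
    obtain ⟨ih1, ih2⟩ := ih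
    have hadm : ∀ v ∈ X, IsAdmissible d ((numColors d)^[s] m) (reduceColors d m out φ s v)
        (reduceColors d m out φ s '' out v) := by
      intro v hv
      refine ⟨ih1 v hv, (hfin v hv).image _, (Set.ncard_image_le (hfin v hv)).trans (hcard v hv),
        ?_, ?_⟩
      · rintro _ ⟨w, hw, rfl⟩
        exact ih1 w (hsub v hv hw)
      · rintro ⟨w, hw, h⟩
        exact ih2 v hv w hw h.symm
    refine ⟨fun v _ => ?_, fun v hv w hw => ?_⟩
    · rw [Function.iterate_succ_apply']
      exact recolor_lt _ _ _ _
    · exact recolor_ne (hadm v hv) (hadm w (hsub v hv hw)) (Set.mem_image_of_mem _ hw)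

/-! ### The number of color reduction steps -/

theorem numColors_mono (d : ℕ) : Monotone (numColors d) := fun a b h => by
  unfold numColors
  gcongr

theorem numColors_ne_zero (d m : ℕ) : numColors d m ≠ 0 :=
  pow_ne_zero _ (by omega)

theorem numColors_two_pow (d z : ℕ) : numColors d (2 ^ z) = (2 * ((z + 1) * d + 1)) ^ 2 := by
  rw [numColors, Nat.log_pow (by norm_num)]

theorem log_add_le {w : ℕ} (hw : 1024 ≤ w) : 32 * Nat.log 2 (w + 1) + 100 ≤ w := by
  have h1 : 10 ≤ Nat.log 2 (w + 1) := Nat.le_log_of_pow_le (by norm_num) (by norm_num; omega)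
  have h2 : 2 ^ Nat.log 2 (w + 1) ≤ w + 1 := Nat.pow_log_le_self 2 (by omega)
  have h3 : ∀ L, 10 ≤ L → 32 * L + 101 ≤ 2 ^ L := by
    intro L hL
    induction L, hL using Nat.le_induction with
    | base => norm_num
    | succ L _ ih => rw [pow_succ]; omega
  have := h3 _ h1
  omega

/-- The exponent of the number of colors below which color reduction stops to be fast. -/
def threshold (d : ℕ) : ℕ := (d + 1024) ^ 4

theorem exists_fourth_root (l : ℕ) : ∃ w, w ^ 4 ≤ l ∧ l < (w + 1) ^ 4 :=
  ⟨Nat.nthRoot 4 l, Nat.pow_nthRoot_le (by norm_num), Nat.lt_pow_nthRoot_add_one (by norm_num) _⟩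

/-- With w the integer fourth root of log m, the first step leaves O(w ^ 10) colors. The second
leaves O((w log w) ^ 2), which is at most w ^ 4 because the threshold makes w large and forces d <
w. -/
theorem numColors_numColors_le {d m : ℕ} (h : 2 ^ threshold d < m) :
    numColors d (numColors d m) ≤ Nat.log 2 m := by
  set l := Nat.log 2 m with hl
  have hlt : threshold d ≤ l := Nat.le_log_of_pow_le (by norm_num) h.le
  obtain ⟨w, hw1, hw2⟩ := exists_fourth_root l
  have hdw : d + 1024 ≤ w := by
    have : (d + 1024) ^ 4 < (w + 1) ^ 4 := lt_of_le_of_lt hlt hw2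
    have := lt_of_pow_lt_pow_left₀ 4 (by omega) this
    omega
  set L := Nat.log 2 (w + 1) with hL
  have hL1 := log_add_le (w := w) (by omega)
  have hw3 : w + 1 < 2 ^ (L + 1) := Nat.lt_pow_succ_log_self (by norm_num) _
  have h1 : numColors d m < 2 ^ (10 * (L + 1) + 2) := by
    have ha : numColors d m = (2 * ((l + 1) * d + 1)) ^ 2 := rfl
    have hb : (l + 1) * d + 1 ≤ (w + 1) ^ 5 := by
      calc (l + 1) * d + 1 ≤ (w + 1) ^ 4 * d + (w + 1) ^ 4 := by
            gcongr
            · omega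
            · exact Nat.one_le_pow _ _ (by omega)
        _ = (w + 1) ^ 4 * (d + 1) := by ring
        _ ≤ (w + 1) ^ 4 * (w + 1) := by gcongr; omega
        _ = _ := by ring
    calc numColors d m ≤ (2 * (w + 1) ^ 5) ^ 2 := by rw [ha]; gcongr
      _ = 4 * (w + 1) ^ 10 := by ring
      _ < 4 * (2 ^ (L + 1)) ^ 10 := by gcongr
      _ = _ := by rw [pow_add 2 (10 * (L + 1)), mul_comm 10 (L + 1), pow_mul 2]; ring
  have h2 : Nat.log 2 (numColors d m) < 10 * (L + 1) + 2 :=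
    Nat.log_lt_of_lt_pow (numColors_ne_zero d m) h1
  have h3 : (Nat.log 2 (numColors d m) + 1) * d + 1 ≤ (10 * L + 13) * w := by
    have : (Nat.log 2 (numColors d m) + 1) * d ≤ (10 * L + 12) * w :=
      Nat.mul_le_mul (by omega) (by omega)
    nlinarith
  calc numColors d (numColors d m)
      = (2 * ((Nat.log 2 (numColors d m) + 1) * d + 1)) ^ 2 := rfl
    _ ≤ (2 * ((10 * L + 13) * w)) ^ 2 := by gcongr
    _ = ((20 * L + 26) * w) ^ 2 := by ring
    _ ≤ (w * w) ^ 2 := by gcongr; omega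
    _ = w ^ 4 := by ring
    _ ≤ l := hw1

theorem sq_le_two_pow {z : ℕ} (hz : 64 ≤ z) : (2 * ((z + 1) * z + 1)) ^ 2 ≤ 2 ^ z := by
  induction z, hz using Nat.le_induction with
  | base => norm_num
  | succ z hz ih =>
    rw [pow_succ 2 z]
    refine le_trans ?_ (Nat.mul_le_mul_right 2 ih)
    have h : 5 * ((z + 1 + 1) * (z + 1) + 1) ≤ 7 * ((z + 1) * z + 1) := by nlinarith
    nlinarith

theorem le_threshold (d : ℕ) : d + 1024 ≤ threshold d :=
  Nat.le_self_pow (by norm_num) _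

theorem numColors_two_pow_threshold_le (d : ℕ) :
    numColors d (2 ^ threshold d) ≤ 2 ^ threshold d := by
  have h := le_threshold d
  rw [numColors_two_pow]
  refine le_trans ?_ (sq_le_two_pow (z := threshold d) (by omega))
  gcongr
  omega

/-- The number of steps is fixed in advance, so further steps must not undo what has been reached.
-/
theorem iterate_numColors_le_of_le {d m : ℕ} (h : m ≤ 2 ^ threshold d) (s : ℕ) :
    (numColors d)^[s] m ≤ 2 ^ threshold d := by
  induction s generalizing m with
  | zero => exact h
  | succ s ih =>
    exact ih ((numColors_mono d h).trans (numColors_two_pow_threshold_le d))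

/-- Above the threshold, two steps do at least as well as one logarithm, that is, as one level of
the tower. -/
theorem iterate_numColors_le (d : ℕ) {j m : ℕ} (h : m ≤ tower j) :
    (numColors d)^[2 * j] m ≤ 2 ^ threshold d := by
  induction j generalizing m with
  | zero => exact h.trans (by simpa [tower] using Nat.one_le_two_pow)
  | succ j ih =>
    by_cases hm : m ≤ 2 ^ threshold d
    · exact iterate_numColors_le_of_le hm _
    · rw [mul_add, mul_one, Function.iterate_add_apply]
      refine ih ((numColors_numColors_le (not_le.1 hm)).trans ?_)
      have := Nat.log_mono_right (b := 2) h
      rwa [tower, Nat.log_pow (by norm_num)] at this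

/-- The number of color reduction steps from `m` colors to `finalColors d` colors. -/
noncomputable def numSteps (m : ℕ) : ℕ := 2 * logStar m + 1

/-- The number of colors that color reduction arrives at for out-degree `d`. -/
def finalColors (d : ℕ) : ℕ := (2 * ((threshold d + 1) * d + 1)) ^ 2

/-- The last step turns the exponential bound `2 ^ threshold d` into one polynomial in d. -/
theorem iterate_numColors_numSteps_le (d m : ℕ) :
    (numColors d)^[numSteps m] m ≤ finalColors d := by
  rw [numSteps, Function.iterate_succ_apply', finalColors, ← numColors_two_pow]
  exact numColors_mono d (iterate_numColors_le d (le_tower_logStar m))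

theorem finalColors_le (d : ℕ) : finalColors d ≤ 2 ^ threshold d := by
  rw [finalColors, ← numColors_two_pow]
  exact numColors_two_pow_threshold_le d

/-! ### Locality -/

/-- The edge sets `E` and `E'` look the same to node `i` within distance `t`: the nodes at distance
less than `t` have the same incident edges. -/
def Agree : ℕ → Set (Set ℕ) → Set (Set ℕ) → ℕ → Prop
  | 0, _, _, _ => True
  | t + 1, E, E', i => (∀ e, i ∈ e → (e ∈ E ↔ e ∈ E')) ∧ ∀ e ∈ E, i ∈ e → ∀ j ∈ e, Agree t E E' j

theorem Agree.of_succ {t : ℕ} {E E' : Set (Set ℕ)} {i : ℕ} (h : Agree (t + 1) E E' i) :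
    Agree t E E' i := by
  induction t generalizing i with
  | zero => trivial
  | succ t ih => exact ⟨h.1, fun e he hi j hj => ih (h.2 e he hi j hj)⟩

theorem Agree.mono {t s : ℕ} (hst : s ≤ t) {E E' : Set (Set ℕ)} {i : ℕ} (h : Agree t E E' i) :
    Agree s E E' i := by
  induction t, hst using Nat.le_induction with
  | base => exact h
  | succ t _ ih => exact ih h.of_succ

/-- The node labeling `f` of the hypergraph with a given edge set is determined by what the nodes
see within distance `t`. -/
def NodeLocal {α : Type*} (t : ℕ) (f : Set (Set ℕ) → ℕ → α) : Prop :=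
  ∀ E E' i, Agree t E E' i → f E i = f E' i

/-- The set `F E` of edges of the hypergraph with edge set `E` is determined by what the nodes see
within distance `t`. -/
def EdgeLocal (t : ℕ) (F : Set (Set ℕ) → Set (Set ℕ)) : Prop :=
  (∀ E, F E ⊆ E) ∧ ∀ E E' i, Agree t E E' i → ∀ e, i ∈ e → (e ∈ F E ↔ e ∈ F E')

theorem NodeLocal.mono {α : Type*} {t s : ℕ} {f : Set (Set ℕ) → ℕ → α} (hf : NodeLocal s f)
    (hst : s ≤ t) : NodeLocal t f := fun E E' i h => hf E E' i (h.mono hst)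

theorem EdgeLocal.mono {t s : ℕ} {F : Set (Set ℕ) → Set (Set ℕ)} (hF : EdgeLocal s F)
    (hst : s ≤ t) : EdgeLocal t F := ⟨hF.1, fun E E' i h => hF.2 E E' i (h.mono hst)⟩

theorem NodeLocal.const {α : Type*} (t : ℕ) (f : ℕ → α) : NodeLocal t fun _ i => f i :=
  fun _ _ _ _ => rfl

theorem EdgeLocal.id : EdgeLocal 1 fun E => E := ⟨fun _ => subset_rfl, fun _ _ _ h => h.1⟩

theorem NodeLocal.sUnion : NodeLocal 1 fun E i => i ∈ ⋃₀ E := fun _ _ _ h =>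
  propext ⟨fun ⟨e, he, hi⟩ => ⟨e, (h.1 e hi).1 he, hi⟩, fun ⟨e, he, hi⟩ => ⟨e, (h.1 e hi).2 he, hi⟩⟩

section

variable {t : ℕ} {F : Set (Set ℕ) → Set (Set ℕ)} {X Y : Set (Set ℕ) → Set ℕ}

theorem NodeLocal.mem_iff (hX : NodeLocal t fun E i => i ∈ X E) {E E' : Set (Set ℕ)} {i : ℕ}
    (h : Agree t E E' i) : i ∈ X E ↔ i ∈ X E' := iff_of_eq (hX E E' i h)

/-- Two edge sets that agree around a node of the edge `e` agree around each node of `e`. -/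
theorem EdgeLocal.agree_of_mem (hF : EdgeLocal t F) {E E' : Set (Set ℕ)} {i j : ℕ} {e : Set ℕ}
    (h : Agree (t + 1) E E' i) (he : e ∈ F E) (hi : i ∈ e) (hj : j ∈ e) : Agree t E E' j :=
  h.2 e (hF.1 E he) hi j hj

theorem NodeLocal.inter (hX : NodeLocal t fun E i => i ∈ X E) (hY : NodeLocal t fun E i => i ∈ Y E) :
    NodeLocal t fun E i => i ∈ X E ∩ Y E := fun _ _ _ h =>
  propext (and_congr (hX.mem_iff h) (hY.mem_iff h))

theorem NodeLocal.union (hX : NodeLocal t fun E i => i ∈ X E) (hY : NodeLocal t fun E i => i ∈ Y E) :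
    NodeLocal t fun E i => i ∈ X E ∪ Y E := fun _ _ _ h =>
  propext (or_congr (hX.mem_iff h) (hY.mem_iff h))

theorem NodeLocal.diff (hX : NodeLocal t fun E i => i ∈ X E) (hY : NodeLocal t fun E i => i ∈ Y E) :
    NodeLocal t fun E i => i ∈ X E \ Y E := fun _ _ _ h =>
  propext (and_congr (hX.mem_iff h) (not_congr (hY.mem_iff h)))

/-- Locality of properties of the nodes that depend on their incident edges in `F` and on the
labels of the nodes in these edges. -/
theorem NodeLocal.of_incident {α β : Type*} (hF : EdgeLocal t F) {f : Set (Set ℕ) → ℕ → α}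
    (hf : NodeLocal t f) {g : Set (Set ℕ) → ℕ → β}
    (hg : ∀ E E' i, (∀ e, i ∈ e → (e ∈ F E ↔ e ∈ F E')) → f E i = f E' i →
      (∀ e ∈ F E, i ∈ e → ∀ j ∈ e, f E j = f E' j) → g E i = g E' i) :
    NodeLocal (t + 1) g := fun E E' i h =>
  hg E E' i (hF.2 E E' i h.of_succ) (hf E E' i h.of_succ)
    fun _ he hi j hj => hf E E' j (hF.agree_of_mem h he hi hj)

/-- The edges of `F` that are not hit by `X`. -/
def unhit (F : Set (Set ℕ)) (X : Set ℕ) : Set (Set ℕ) := {e | e ∈ F ∧ Disjoint e X}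

theorem EdgeLocal.unhit (hF : EdgeLocal t F) (hX : NodeLocal t fun E i => i ∈ X E) :
    EdgeLocal (t + 1) fun E => unhit (F E) (X E) := by
  refine ⟨fun E e he => hF.1 E he.1, fun E E' i h e hi => ?_⟩
  have h1 := hF.2 E E' i h.of_succ e hi
  refine ⟨fun he => ⟨h1.1 he.1, ?_⟩, fun he => ⟨h1.2 he.1, ?_⟩⟩ <;>
  · rw [Set.disjoint_left]
    intro j hj
    have h2 : j ∈ X E ↔ j ∈ X E' :=
      hX.mem_iff (hF.agree_of_mem h (by first | exact he.1 | exact h1.2 he.1) hi hj)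
    have h3 := Set.disjoint_left.1 he.2 hj
    simpa [h2] using h3

/-- The nodes that have a private edge in `F`, an edge that contains no other node of `X`. -/
def withPrivate (F : Set (Set ℕ)) (X : Set ℕ) : Set ℕ := {v | ∃ e ∈ F, e ∩ X = {v}}

theorem withPrivate_subset (F : Set (Set ℕ)) (X : Set ℕ) : withPrivate F X ⊆ X := by
  rintro v ⟨e, _, h⟩
  exact (h.symm ▸ Set.mem_singleton v : v ∈ e ∩ X).2

theorem inter_congr_of_forall {e X X' : Set ℕ} (h : ∀ j ∈ e, (j ∈ X) = (j ∈ X')) :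
    e ∩ X = e ∩ X' := by
  ext j
  exact and_congr_right fun hj => iff_of_eq (h j hj)

theorem NodeLocal.withPrivate (hF : EdgeLocal t F) (hX : NodeLocal t fun E i => i ∈ X E) :
    NodeLocal (t + 1) fun E i => i ∈ withPrivate (F E) (X E) := by
  refine NodeLocal.of_incident hF hX fun E E' i h1 _ h2 => propext ⟨?_, ?_⟩
  · rintro ⟨e, he, h⟩
    have hi : i ∈ e := (h.symm ▸ Set.mem_singleton i : i ∈ e ∩ X E).1
    exact ⟨e, (h1 e hi).1 he, by rw [← h, inter_congr_of_forall (h2 e he hi)]⟩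
  · rintro ⟨e, he, h⟩
    have hi : i ∈ e := (h.symm ▸ Set.mem_singleton i : i ∈ e ∩ X E').1
    have he' := (h1 e hi).2 he
    exact ⟨e, he', by rw [← h, inter_congr_of_forall (h2 e he' hi)]⟩

/-- Each step reads colors one edge away and so costs one unit of radius. The arcs may need radius t
+ 1, since they are first read in the first step. -/
theorem NodeLocal.reduceColors (hF : ∀ E, F E ⊆ E) {out : Set (Set ℕ) → ℕ → Set ℕ}
    (hout : NodeLocal (t + 1) out)
    (hsub : ∀ E v, ∀ w ∈ out E v, ∃ e ∈ F E, v ∈ e ∧ w ∈ e) {φ : Set (Set ℕ) → ℕ → ℕ}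
    (hφ : NodeLocal t φ) (d m s : ℕ) :
    NodeLocal (t + s) fun E => reduceColors d m (out E) (φ E) s := by
  induction s with
  | zero => exact hφ
  | succ s ih =>
    intro E E' i h
    have h1 : out E i = out E' i := hout E E' i (h.mono (by omega))
    have h2 := ih E E' i (h.mono (by omega))
    have h3 : _root_.reduceColors d m (out E) (φ E) s '' out E i =
        _root_.reduceColors d m (out E') (φ E') s '' out E' i := by
      rw [← h1]
      refine Set.image_congr fun w hw => ?_
      obtain ⟨e, he, hi, hw⟩ := hsub E i w hw
      exact ih E E' w (h.2 e (hF E he) hi w hw)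
    simp only [_root_.reduceColors] at h2 ⊢
    rw [h2, h3]

end

/-! ### Minimal hitting sets -/

/-- The representatives of the edges: each edge of `F` selects its smallest node in `X`. -/
def reps (F : Set (Set ℕ)) (X : Set ℕ) : Set ℕ :=
  {v | ∃ e ∈ F, v ∈ e ∧ v ∈ X ∧ sInf (e ∩ X) = v}

/-- The other nodes that are selected by the edges of a node. -/
def selected (F : Set (Set ℕ)) (X : Set ℕ) (v : ℕ) : Set ℕ :=
  {w | w ≠ v ∧ ∃ e ∈ F, v ∈ e ∧ w ∈ e ∧ w ∈ X ∧ sInf (e ∩ X) = w}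

/-- The coloring of the nodes of `X` in which the node that an edge selects has a color of its
own. -/
noncomputable def selectionColoring (d m : ℕ) (φ : ℕ → ℕ) (F : Set (Set ℕ)) (X : Set ℕ) :
    ℕ → ℕ :=
  reduceColors d m (selected F X) φ (numSteps m)

/-- Replacement of the nodes of one color in a hitting set: those with a private edge stay, and
`sub` finds a hitting set among the others for the edges that are not hit otherwise. -/
def sweepStep (sub : Set (Set ℕ) → Set ℕ → Set ℕ) (F : Set (Set ℕ)) (γ : ℕ → ℕ) (i : ℕ)
    (Y : Set ℕ) : Set ℕ :=
  Y \ γ ⁻¹' {i} ∪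
    (withPrivate (unhit F (Y \ γ ⁻¹' {i})) (Y ∩ γ ⁻¹' {i}) ∪
      sub (unhit (unhit F (Y \ γ ⁻¹' {i}))
          (withPrivate (unhit F (Y \ γ ⁻¹' {i})) (Y ∩ γ ⁻¹' {i})))
        ((Y ∩ γ ⁻¹' {i}) \ withPrivate (unhit F (Y \ γ ⁻¹' {i})) (Y ∩ γ ⁻¹' {i})))

/-- Replacement of the nodes of the colors `0, …, i - 1`, one color after the other. -/
def sweep (sub : Set (Set ℕ) → Set ℕ → Set ℕ) (F : Set (Set ℕ)) (γ : ℕ → ℕ) (Y : Set ℕ) :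
    ℕ → Set ℕ
  | 0 => Y
  | i + 1 => sweepStep sub F γ i (sweep sub F γ Y i)

/-- A minimal hitting set inside `X` of the edges in `F`, if each node of `X` lies in at most `k`
of these edges and `φ` is a coloring of `X` with `m` colors. -/
noncomputable def minHit (d m : ℕ) (φ : ℕ → ℕ) : ℕ → Set (Set ℕ) → Set ℕ → Set ℕ
  | 0 => fun _ _ => ∅
  | k + 1 => fun F X =>
      sweep (minHit d m φ k) F (selectionColoring d m φ F X) (reps F X) (finalColors d)

/-- `Y` is a hitting set of `F`. -/
def Hits (F : Set (Set ℕ)) (Y : Set ℕ) : Prop := ∀ e ∈ F, (e ∩ Y).Nonempty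

theorem not_mem_unhit {F : Set (Set ℕ)} {Y : Set ℕ} {e : Set ℕ} (he : e ∈ F)
    (h : e ∉ unhit F Y) : (e ∩ Y).Nonempty := by
  by_contra h'
  exact h ⟨he, Set.disjoint_iff_inter_eq_empty.2 (Set.not_nonempty_iff_eq_empty.1 h')⟩

section

variable {sub : Set (Set ℕ) → Set ℕ → Set ℕ} {F : Set (Set ℕ)} {γ : ℕ → ℕ} {i : ℕ} {Y : Set ℕ}

theorem sweepStep_subset (hsub : ∀ F' X', sub F' X' ⊆ X') : sweepStep sub F γ i Y ⊆ Y := by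
  refine Set.union_subset Set.sdiff_subset (Set.union_subset ?_ ?_)
  · exact (withPrivate_subset _ _).trans Set.inter_subset_left
  · exact (hsub _ _).trans (Set.sdiff_subset.trans Set.inter_subset_left)

theorem sweep_subset (hsub : ∀ F' X', sub F' X' ⊆ X') : sweep sub F γ Y i ⊆ Y := by
  induction i with
  | zero => exact subset_rfl
  | succ i ih => exact (sweepStep_subset hsub).trans ih

theorem minHit_subset (d m : ℕ) (φ : ℕ → ℕ) (k : ℕ) (F : Set (Set ℕ)) (X : Set ℕ) :
    minHit d m φ k F X ⊆ X := by
  induction k generalizing F X with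
  | zero => exact Set.empty_subset _
  | succ k ih =>
    refine (sweep_subset ih).trans ?_
    rintro v ⟨e, -, -, hv, -⟩
    exact hv

/-- A private edge remains private as long as it is hit by the smaller set. -/
theorem mem_withPrivate_of_subset {Y' : Set ℕ} (hY : Y' ⊆ Y) (hit : Hits F Y') {v : ℕ}
    (hv : v ∈ withPrivate F Y) : v ∈ withPrivate F Y' := by
  obtain ⟨e, he, h⟩ := hv
  refine ⟨e, he, (Set.Nonempty.subset_singleton_iff (hit e he)).1 ?_⟩
  rw [← h]
  exact Set.inter_subset_inter_right e hY

/-- An edge that misses R meets R ∪ Z only in Z, so privacy among the unhit edges is privacy in the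
whole set. -/
theorem mem_withPrivate_union {R Z : Set ℕ} {v : ℕ} (h : v ∈ withPrivate (unhit F R) Z) :
    v ∈ withPrivate F (R ∪ Z) := by
  obtain ⟨e, he, h⟩ := h
  exact ⟨e, he.1, by rw [Set.inter_union_distrib_left, he.2.inter_eq, Set.empty_union, h]⟩

/-- What `sweepStep` achieves: the set remains a hitting set, and the nodes of the given color that
it contains afterwards have private edges. -/
theorem sweepStep_spec (hsub : ∀ F' X', sub F' X' ⊆ X') (hY : Hits F Y)
    (hit : ∀ F' X', F' ⊆ F → X' ⊆ Y → Hits F' X' →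
      (∀ v ∈ X', ∀ e ∈ F, v ∈ e → (∀ w ∈ e, w ∈ Y → γ w = γ v → w = v) → e ∉ F') →
      Hits F' (sub F' X') ∧ sub F' X' ⊆ withPrivate F' (sub F' X')) :
    Hits F (sweepStep sub F γ i Y) ∧
      ∀ v ∈ sweepStep sub F γ i Y, γ v = i → v ∈ withPrivate F (sweepStep sub F γ i Y) := by
  have hle : sweepStep sub F γ i Y ⊆ Y := sweepStep_subset hsub
  unfold sweepStep at hle ⊢
  set R := Y \ γ ⁻¹' {i} with hR
  set C := Y ∩ γ ⁻¹' {i} with hC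
  set Z := withPrivate (unhit F R) C with hZ
  set F' := unhit (unhit F R) Z with hF'
  have hRC : R ∪ C = Y := Set.sdiff_union_inter Y _
  obtain ⟨h1, h2⟩ := hit F' (C \ Z) (fun e he => he.1.1)
    (Set.sdiff_subset.trans Set.inter_subset_left) (by
      intro e he
      obtain ⟨v, hve, hvY⟩ := hY e he.1.1
      rw [← hRC] at hvY
      exact ⟨v, hve, hvY.resolve_left (Set.disjoint_left.1 he.1.2 hve),
        Set.disjoint_left.1 he.2 hve⟩) (by
      -- If e were still unhit, it would miss R and contain no other node of this color, so it would
      -- be private to v and put v into Z.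
      intro v hv e _ hve huniq he'
      refine hv.2 ⟨e, he'.1, Set.eq_singleton_iff_unique_mem.2 ⟨⟨hve, hv.1⟩, ?_⟩⟩
      rintro w ⟨hwe, hwY, hw⟩
      exact huniq w hwe hwY (Eq.trans hw (Eq.symm hv.1.2)))
  have h3 : Hits F (R ∪ (Z ∪ sub F' (C \ Z))) := by
    intro e he
    by_cases he1 : e ∈ unhit F R
    · by_cases he2 : e ∈ F'
      · exact (h1 e he2).mono (Set.inter_subset_inter_right e
          (Set.subset_union_right.trans Set.subset_union_right))
      · exact (not_mem_unhit he1 he2).mono (Set.inter_subset_inter_right e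
          (Set.subset_union_left.trans Set.subset_union_right))
    · exact (not_mem_unhit he he1).mono (Set.inter_subset_inter_right e Set.subset_union_left)
  refine ⟨h3, ?_⟩
  rintro v (hv | hv | hv) hvi
  · exact absurd hvi hv.2
  · refine mem_withPrivate_of_subset hle h3 ?_
    rw [← hRC]
    exact mem_withPrivate_union hv
  · exact mem_withPrivate_union (mem_withPrivate_union (h2 hv))

/-- Private edges survive later steps because the set only shrinks and stays a hitting set. The
hypothesis on `sub` can refer to the initial Y: a node alone of its color in e ∩ Y remains so in
smaller sets. -/
theorem sweep_spec (hsub : ∀ F' X', sub F' X' ⊆ X') (hY : Hits F Y)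
    (hit : ∀ F' X', F' ⊆ F → X' ⊆ Y → Hits F' X' →
      (∀ v ∈ X', ∀ e ∈ F, v ∈ e → (∀ w ∈ e, w ∈ Y → γ w = γ v → w = v) → e ∉ F') →
      Hits F' (sub F' X') ∧ sub F' X' ⊆ withPrivate F' (sub F' X')) :
    Hits F (sweep sub F γ Y i) ∧
      ∀ v ∈ sweep sub F γ Y i, γ v < i → v ∈ withPrivate F (sweep sub F γ Y i) := by
  induction i with
  | zero => exact ⟨hY, fun v _ h => absurd h (Nat.not_lt_zero _)⟩
  | succ i ih =>
    have hle : sweep sub F γ Y i ⊆ Y := sweep_subset hsub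
    obtain ⟨h1, h2⟩ := sweepStep_spec (i := i) hsub ih.1 fun F' X' hF' hX' hh hu =>
      hit F' X' hF' (hX'.trans hle) hh fun v hv e he hve h =>
        hu v hv e he hve fun w hwe hw => h w hwe (hle hw)
    refine ⟨h1, fun v hv hvi => ?_⟩
    rcases Nat.lt_succ_iff_lt_or_eq.1 hvi with h | h
    · exact mem_withPrivate_of_subset (sweepStep_subset hsub) h1
        (ih.2 v (sweepStep_subset hsub hv) h)
    · exact h2 v hv h

end

section

variable {d m k : ℕ} {φ : ℕ → ℕ} {F : Set (Set ℕ)} {X : Set ℕ}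

/-- Each edge selects a single node, which bounds the out-degree by the degree, independently of the
rank. -/
theorem selected_subset_image (v : ℕ) :
    selected F X v ⊆ (fun e => sInf (e ∩ X)) '' {e | e ∈ F ∧ v ∈ e} := by
  rintro w ⟨-, e, he, hv, -, -, h⟩
  exact ⟨e, ⟨he, hv⟩, h⟩

theorem selectionColoring_spec (hdeg : ∀ v ∈ X, {e | e ∈ F ∧ v ∈ e}.Finite)
    (hd : ∀ v ∈ X, {e | e ∈ F ∧ v ∈ e}.ncard ≤ d) (hm : ∀ v ∈ X, φ v < m)
    (hφ : ∀ e ∈ F, ∀ v ∈ e, ∀ w ∈ e, v ∈ X → w ∈ X → v ≠ w → φ v ≠ φ w) :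
    (∀ v ∈ X, selectionColoring d m φ F X v < finalColors d) ∧
      ∀ v ∈ X, ∀ w ∈ selected F X v,
        selectionColoring d m φ F X v ≠ selectionColoring d m φ F X w := by
  have h := reduceColors_spec (d := d) (m := m) (out := selected F X) (φ := φ) (X := X)
    (by rintro v - w ⟨-, e, -, -, -, hw, -⟩; exact hw)
    (fun v hv => ((hdeg v hv).image _).subset (selected_subset_image v))
    (fun v hv => (Set.ncard_le_ncard (selected_subset_image v) ((hdeg v hv).image _)).trans
      ((Set.ncard_image_le (hdeg v hv)).trans (hd v hv)))
    hm (by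
      rintro v hv w ⟨hwv, e, he, hve, hwe, hw, -⟩
      exact hφ e he v hve w hwe hv hw hwv.symm) (numSteps m)
  exact ⟨fun v hv => (h.1 v hv).trans_le (iterate_numColors_numSteps_le d m), h.2⟩

theorem reps_subset : reps F X ⊆ X := by
  rintro v ⟨e, -, -, hv, -⟩
  exact hv

theorem hits_reps (hX : Hits F X) : Hits F (reps F X) := by
  intro e he
  have h := Nat.sInf_mem (hX e he)
  exact ⟨sInf (e ∩ X), h.1, e, he, h.1, h.2, rfl⟩

/-- Induction on the degree bound k, with d fixed so that the palette is the same at every depth.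
For k = 0 no edge meets X, so a family hit by X is empty. -/
theorem minHit_spec (hk : k ≤ d) (hX : Hits F X) (hdeg : ∀ v ∈ X, {e | e ∈ F ∧ v ∈ e}.Finite)
    (hd : ∀ v ∈ X, {e | e ∈ F ∧ v ∈ e}.ncard ≤ k) (hm : ∀ v ∈ X, φ v < m)
    (hφ : ∀ e ∈ F, ∀ v ∈ e, ∀ w ∈ e, v ∈ X → w ∈ X → v ≠ w → φ v ≠ φ w) :
    Hits F (minHit d m φ k F X) ∧
      minHit d m φ k F X ⊆ withPrivate F (minHit d m φ k F X) := by
  induction k generalizing F X with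
  | zero =>
    refine ⟨fun e he => ?_, Set.empty_subset _⟩
    obtain ⟨v, hve, hv⟩ := hX e he
    have h := (Set.ncard_eq_zero (hdeg v hv)).1 (Nat.le_zero.1 (hd v hv))
    have hmem : e ∈ {e | e ∈ F ∧ v ∈ e} := ⟨he, hve⟩
    rw [h] at hmem
    exact hmem.elim
  | succ k ih =>
    obtain ⟨hγ1, hγ2⟩ := selectionColoring_spec hdeg (fun v hv => (hd v hv).trans hk) hm hφ
    obtain ⟨h1, h2⟩ := sweep_spec (i := finalColors d) (γ := selectionColoring d m φ F X)
      (minHit_subset d m φ k) (hits_reps hX) (by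
        intro F' X' hF' hX' hh hu
        have hX'' : X' ⊆ X := hX'.trans reps_subset
        have hle : ∀ v, {e | e ∈ F' ∧ v ∈ e} ⊆ {e | e ∈ F ∧ v ∈ e} :=
          fun v e he => ⟨hF' he.1, he.2⟩
        refine ih (by omega) hh (fun v hv => (hdeg v (hX'' hv)).subset (hle v)) (fun v hv => ?_)
          (fun v hv => hm v (hX'' hv))
          fun e he v hve w hwe hv hw => hφ e (hF' he) v hve w hwe (hX'' hv) (hX'' hw)
        -- Let e be an edge that selected v. All other representatives in e have an arc to v, hence
        -- another color, so e is absent from F' and the degree of v drops.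
        obtain ⟨e, he, hve, -, hev⟩ := hX' hv
        have he' : e ∉ F' := by
          refine hu v hv e he hve fun w hwe hw hwγ => ?_
          by_contra hne
          exact hγ2 w (reps_subset hw) v
            ⟨fun h => hne h.symm, e, he, hwe, hve, hX'' hv, hev⟩ hwγ
        have hlt : {e | e ∈ F' ∧ v ∈ e}.ncard < {e | e ∈ F ∧ v ∈ e}.ncard :=
          Set.ncard_lt_ncard ⟨hle v, fun h => he' (h ⟨he, hve⟩).1⟩ (hdeg v (hX'' hv))
        have := hd v (hX'' hv)
        omega)
    exact ⟨h1, fun v hv => h2 v hv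
      (hγ1 v (reps_subset (sweep_subset (minHit_subset d m φ k) hv)))⟩

end

/-! ### Locality of the computation of a minimal hitting set -/

section

variable {t τ : ℕ} {F : Set (Set ℕ) → Set (Set ℕ)} {X Y : Set (Set ℕ) → Set ℕ}
  {γ φ : Set (Set ℕ) → ℕ → ℕ} {sub : Set (Set ℕ) → Set (Set ℕ) → Set ℕ → Set ℕ}

theorem NodeLocal.reps (hF : EdgeLocal t F) (hX : NodeLocal t fun E i => i ∈ X E) :
    NodeLocal (t + 1) fun E i => i ∈ reps (F E) (X E) := by
  refine NodeLocal.of_incident hF hX fun E E' i h1 h2 h3 => propext ⟨?_, ?_⟩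
  · rintro ⟨e, he, hi, hX, h⟩
    exact ⟨e, (h1 e hi).1 he, hi, h2 ▸ hX, by rw [← h, inter_congr_of_forall (h3 e he hi)]⟩
  · rintro ⟨e, he, hi, hX, h⟩
    have he' := (h1 e hi).2 he
    exact ⟨e, he', hi, h2 ▸ hX, by rw [← h, inter_congr_of_forall (h3 e he' hi)]⟩

theorem NodeLocal.selected (hF : EdgeLocal t F) (hX : NodeLocal t fun E i => i ∈ X E) :
    NodeLocal (t + 1) fun E => selected (F E) (X E) := by
  refine NodeLocal.of_incident hF hX fun E E' i h1 _ h3 => ?_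
  ext w
  refine and_congr_right fun _ => ⟨?_, ?_⟩
  · rintro ⟨e, he, hi, hw, hwX, h⟩
    exact ⟨e, (h1 e hi).1 he, hi, hw, h3 e he hi w hw ▸ hwX,
      by rw [← h, inter_congr_of_forall (h3 e he hi)]⟩
  · rintro ⟨e, he, hi, hw, hwX, h⟩
    have he' := (h1 e hi).2 he
    exact ⟨e, he', hi, hw, h3 e he' hi w hw ▸ hwX,
      by rw [← h, inter_congr_of_forall (h3 e he' hi)]⟩

theorem NodeLocal.selectionColoring (hF : EdgeLocal t F) (hX : NodeLocal t fun E i => i ∈ X E)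
    (hφ : NodeLocal t φ) (d m : ℕ) :
    NodeLocal (t + numSteps m) fun E => selectionColoring d m (φ E) (F E) (X E) :=
  NodeLocal.reduceColors hF.1 (NodeLocal.selected hF hX)
    (fun _ _ _ ⟨_, e, he, hv, hw, _⟩ => ⟨e, he, hv, hw⟩) hφ d m _

/-- The three extra units of radius pay for the edges missed by the other colors, the private edges,
and the edges still unhit. `sub` is required to be local only from radius t on, because the coloring
inside it is known only from there. -/
theorem NodeLocal.sweepStep
    (hsub : ∀ s, t ≤ s → ∀ (F : Set (Set ℕ) → Set (Set ℕ)) (X : Set (Set ℕ) → Set ℕ),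
      EdgeLocal s F → (NodeLocal s fun E i => i ∈ X E) →
      NodeLocal (s + τ) fun E i => i ∈ sub E (F E) (X E))
    (hF : EdgeLocal t F) (hγ : NodeLocal t γ) (hY : NodeLocal t fun E i => i ∈ Y E) (c : ℕ) :
    NodeLocal (t + (τ + 3)) fun E i => i ∈ sweepStep (sub E) (F E) (γ E) c (Y E) := by
  have hpre : NodeLocal t fun E i => i ∈ γ E ⁻¹' {c} := fun E E' i h => by
    simp only [Set.mem_preimage, hγ E E' i h]
  have hR := hY.diff hpre
  have hC := hY.inter hpre
  have hZ := NodeLocal.withPrivate (hF.unhit hR) (hC.mono t.le_succ)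
  exact (hR.mono (by omega)).union ((hZ.mono (by omega)).union
    ((hsub (t + 1 + 1 + 1) (by omega) _ _ (((hF.unhit hR).mono (t + 1).le_succ).unhit hZ)
      (((hC.mono (by omega)).diff hZ).mono (by omega))).mono (by omega)))

theorem NodeLocal.sweep
    (hsub : ∀ s, t ≤ s → ∀ (F : Set (Set ℕ) → Set (Set ℕ)) (X : Set (Set ℕ) → Set ℕ),
      EdgeLocal s F → (NodeLocal s fun E i => i ∈ X E) →
      NodeLocal (s + τ) fun E i => i ∈ sub E (F E) (X E))
    (hF : EdgeLocal t F) (hγ : NodeLocal t γ) (hY : NodeLocal t fun E i => i ∈ Y E) (c : ℕ) :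
    NodeLocal (t + c * (τ + 3)) fun E i => i ∈ sweep (sub E) (F E) (γ E) (Y E) c := by
  induction c with
  | zero => simpa [_root_.sweep] using hY
  | succ c ih =>
    rw [add_one_mul, ← add_assoc]
    exact NodeLocal.sweepStep (fun s hs => hsub s (by omega)) (hF.mono (by omega))
      (hγ.mono (by omega)) ih c

/-- The number of rounds for `minHit`. -/
noncomputable def hitRounds (d m : ℕ) : ℕ → ℕ
  | 0 => 0
  | k + 1 => numSteps m + 1 + finalColors d * (hitRounds d m k + 3)

theorem NodeLocal.minHit (hF : EdgeLocal t F) (hX : NodeLocal t fun E i => i ∈ X E)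
    (hφ : NodeLocal t φ) (d m k : ℕ) :
    NodeLocal (t + hitRounds d m k) fun E i => i ∈ minHit d m (φ E) k (F E) (X E) := by
  induction k generalizing t F X with
  | zero => exact NodeLocal.const _ fun _ => False
  | succ k ih =>
    have h := NodeLocal.sweep (sub := fun E => _root_.minHit d m (φ E) k) (τ := hitRounds d m k)
      (t := t + numSteps m + 1) (fun s hs F X hF hX => ih hF hX (hφ.mono (by omega)))
      (hF.mono (by omega)) ((NodeLocal.selectionColoring hF hX hφ d m).mono (by omega))
      ((NodeLocal.reps hF hX).mono (by omega)) (finalColors d)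
    exact h.mono (by rw [hitRounds]; omega)

end

/-! ### The MIS problem on hypergraphs whose nodes are natural numbers -/

/-- The nodes that share an edge with a node. -/
def neighbors (E : Set (Set ℕ)) (v : ℕ) : Set ℕ := {w | w ≠ v ∧ ∃ e ∈ E, v ∈ e ∧ w ∈ e}

/-- A proper coloring of the nodes, computed from the identifiers, which are less than `N`. -/
noncomputable def properColoring (D N : ℕ) (E : Set (Set ℕ)) : ℕ → ℕ :=
  reduceColors D N (neighbors E) id (numSteps N)

/-- A minimal hitting set of the edges of a hypergraph of maximum degree `Δ` and rank `r` whose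
nodes are less than `N`. -/
noncomputable def minimalHittingSet (N Δ r : ℕ) (E : Set (Set ℕ)) : Set ℕ :=
  minHit Δ (finalColors (Δ * r)) (properColoring (Δ * r) N E) Δ E (⋃₀ E)

/-- The number of rounds for `minimalHittingSet`. -/
noncomputable def minimalHittingSetRounds (N Δ r : ℕ) : ℕ :=
  numSteps N + 1 + hitRounds Δ (finalColors (Δ * r)) Δ

theorem NodeLocal.neighbors : NodeLocal 1 neighbors := fun E E' i h => by
  ext w
  refine and_congr_right fun _ => ⟨?_, ?_⟩
  · rintro ⟨e, he, hi, hw⟩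
    exact ⟨e, (h.1 e hi).1 he, hi, hw⟩
  · rintro ⟨e, he, hi, hw⟩
    exact ⟨e, (h.1 e hi).2 he, hi, hw⟩

theorem NodeLocal.properColoring (D N : ℕ) : NodeLocal (numSteps N) (properColoring D N) :=
  (NodeLocal.reduceColors (t := 0) (F := fun E => E) (fun _ => subset_rfl) NodeLocal.neighbors
    (fun _ _ _ h => h.2) (NodeLocal.const 0 id) D N (numSteps N)).mono (by omega)

theorem NodeLocal.minimalHittingSet (N Δ r : ℕ) :
    NodeLocal (minimalHittingSetRounds N Δ r) fun E i => i ∈ minimalHittingSet N Δ r E :=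
  NodeLocal.minHit (EdgeLocal.id.mono (by omega)) (NodeLocal.sUnion.mono (by omega))
    ((NodeLocal.properColoring _ _).mono (by omega)) _ _ _

section

variable {N Δ r : ℕ} {E : Set (Set ℕ)}

theorem neighbors_finite_and_ncard_le (hfin : ∀ e ∈ E, e.Finite) (hr : ∀ e ∈ E, e.ncard ≤ r)
    {v : ℕ} (hdeg : {e | e ∈ E ∧ v ∈ e}.Finite) (hΔ : {e | e ∈ E ∧ v ∈ e}.ncard ≤ Δ) :
    (neighbors E v).Finite ∧ (neighbors E v).ncard ≤ Δ * r := by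
  classical
  have hsub : neighbors E v ⊆ ⋃ e ∈ hdeg.toFinset, e := by
    rintro w ⟨-, e, he, hv, hw⟩
    exact Set.mem_biUnion (hdeg.mem_toFinset.2 ⟨he, hv⟩) hw
  have hU : (⋃ e ∈ hdeg.toFinset, e).Finite :=
    hdeg.toFinset.finite_toSet.biUnion fun e he => hfin e (hdeg.mem_toFinset.1 he).1
  refine ⟨hU.subset hsub, (Set.ncard_le_ncard hsub hU).trans ?_⟩
  refine (Finset.set_ncard_biUnion_le _ _).trans ?_
  refine (Finset.sum_le_card_nsmul _ _ r fun e he => hr e (hdeg.mem_toFinset.1 he).1).trans ?_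
  rw [smul_eq_mul, ← Set.ncard_eq_toFinset_card _ hdeg]
  exact Nat.mul_le_mul_right r hΔ

theorem minimalHittingSet_spec (hne : ∀ e ∈ E, e.Nonempty) (hfin : ∀ e ∈ E, e.Finite)
    (hr : ∀ e ∈ E, e.ncard ≤ r) (hdeg : ∀ v ∈ ⋃₀ E, {e | e ∈ E ∧ v ∈ e}.Finite)
    (hΔ : ∀ v ∈ ⋃₀ E, {e | e ∈ E ∧ v ∈ e}.ncard ≤ Δ) (hN : ∀ v ∈ ⋃₀ E, v < N) :
    Hits E (minimalHittingSet N Δ r E) ∧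
      minimalHittingSet N Δ r E ⊆ withPrivate E (minimalHittingSet N Δ r E) := by
  have hcol := reduceColors_spec (d := Δ * r) (m := N) (out := neighbors E) (φ := id)
    (X := ⋃₀ E) (fun v _ w ⟨_, e, he, _, hw⟩ => ⟨e, he, hw⟩)
    (fun v hv => (neighbors_finite_and_ncard_le hfin hr (hdeg v hv) (hΔ v hv)).1)
    (fun v hv => (neighbors_finite_and_ncard_le hfin hr (hdeg v hv) (hΔ v hv)).2)
    hN (fun v _ w hw => hw.1.symm) (numSteps N)
  refine minHit_spec le_rfl ?_ hdeg hΔ ?_ ?_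
  · intro e he
    obtain ⟨v, hv⟩ := hne e he
    exact ⟨v, hv, e, he, hv⟩
  · exact fun v hv => (hcol.1 v hv).trans_le (iterate_numColors_numSteps_le _ _)
  · exact fun e he v hve w hwe hv _ hvw => hcol.2 v hv w ⟨hvw.symm, e, he, hve, hwe⟩

end

/-! ### Full-information algorithms -/

namespace LocalAlgorithm

variable {Out : Type} {V : Type u}

/-- The edges that a node with identifier `i` that knows the edges `K` knows after it received
`M`. -/
def learn (i : ℕ) (K : Set (Set ℕ)) (M : Set (Set (ℕ × Set (Set ℕ)))) : Set (Set ℕ) :=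
  K ∪ {f | ∃ m ∈ M, f = insert i (Prod.fst '' m) ∨ ∃ p ∈ m, f ∈ p.2}

/-- The algorithm in which the nodes send all they know about the edges, and compute their output
from what they know in the end. -/
def fullInformation (out : ℕ → ℕ → ℕ → ℕ → ℕ → Set (Set ℕ) → Out) : LocalAlgorithm Out where
  State := (ℕ × ℕ × ℕ × ℕ × ℕ) × Set (Set ℕ)
  Msg := ℕ × Set (Set ℕ)
  init n Δ r d i := ((n, Δ, r, d, i), ∅)
  send s := (s.1.2.2.2.2, s.2)
  receive s M := (s.1, learn s.1.2.2.2.2 s.2 M)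
  output s := out s.1.1 s.1.2.1 s.1.2.2.1 s.1.2.2.2.1 s.1.2.2.2.2 s.2

/-- The edges of a hypergraph as sets of identifiers. -/
def identEdges (H : Hypergraph V) (ident : V → ℕ) : Set (Set ℕ) :=
  (fun e => ident '' e) '' H.edgeSet

theorem mem_of_ident_mem {H : Hypergraph V} {ident : V → ℕ} (hinj : Set.InjOn ident H.vertexSet)
    {v : V} (hv : v ∈ H.vertexSet) {e : Set V} (he : e ∈ H.edgeSet) (h : ident v ∈ ident '' e) :
    v ∈ e :=
  (hinj.mem_image_iff (H.subset_vertexSet_of_mem_edgeSet he) hv).1 h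

/-- Quantifying over all E' between K and the true edge set makes the induction work: a node's
knowledge contains what its neighbors knew one round earlier, so their agreement statements apply to
the same E'. -/
theorem fullInformation_stateAfter (out : ℕ → ℕ → ℕ → ℕ → ℕ → Set (Set ℕ) → Out) (n Δ r : ℕ)
    {H : Hypergraph V} {ident : V → ℕ} (hinj : Set.InjOn ident H.vertexSet) (t : ℕ) :
    ∀ v ∈ H.vertexSet, ∃ K : Set (Set ℕ),
      (fullInformation out).stateAfter n Δ r H ident t v =
        ((n, Δ, r, H.degree v, ident v), K) ∧
      K ⊆ identEdges H ident ∧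
      ∀ E', K ⊆ E' → E' ⊆ identEdges H ident → Agree t (identEdges H ident) E' (ident v) := by
  induction t with
  | zero => exact fun v _ => ⟨∅, rfl, Set.empty_subset _, fun _ _ _ => trivial⟩
  | succ t ih =>
    choose! K hK hKE hKA using ih
    intro v hv
    let msgs : Set (Set (ℕ × Set (Set ℕ))) :=
      {M | ∃ e ∈ H.edgeSet, v ∈ e ∧ M = (fun w => (ident w, K w)) '' (e \ {v})}
    have hmsgs : {M | ∃ e ∈ H.edgeSet, v ∈ e ∧ M = (fun w => (fullInformation out).send
        ((fullInformation out).stateAfter n Δ r H ident t w)) '' (e \ {v})} = msgs := by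
      ext M
      refine exists_congr fun e => and_congr_right fun he => and_congr_right fun _ => ?_
      have himg : (fun w => (fullInformation out).send
          ((fullInformation out).stateAfter n Δ r H ident t w)) '' (e \ {v}) =
          (fun w => (ident w, K w)) '' (e \ {v}) := by
        refine Set.image_congr fun w hw => ?_
        rw [hK w (H.subset_vertexSet_of_mem_edgeSet he hw.1)]
        rfl
      exact iff_of_eq (congrArg (M = ·) himg)
    -- This covers singleton edges too: they contribute an empty set of messages, to which the node
    -- adds its own identifier.
    have hins : ∀ e ∈ H.edgeSet, v ∈ e →
        insert (ident v) (Prod.fst '' ((fun w => (ident w, K w)) '' (e \ {v}))) = ident '' e := by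
      intro e _ hve
      rw [Set.image_image, ← Set.image_insert_eq, Set.insert_sdiff_singleton,
        Set.insert_eq_of_mem hve]
    refine ⟨learn (ident v) (K v) msgs,
      congrArg₂ (fullInformation out).receive (hK v hv) hmsgs, ?_, ?_⟩
    · rintro f (hf | ⟨m, ⟨e, he, hve, rfl⟩, hf⟩)
      · exact hKE v hv hf
      · rcases hf with rfl | ⟨p, ⟨w, hw, rfl⟩, hf⟩
        · exact ⟨e, he, (hins e he hve).symm⟩
        · exact hKE w (H.subset_vertexSet_of_mem_edgeSet he hw.1) hf
    · intro E' hE' hE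
      refine ⟨fun f hf => ⟨?_, fun h => hE h⟩, ?_⟩
      · rintro ⟨e, he, rfl⟩
        have hve := mem_of_ident_mem hinj hv he hf
        exact hE' (Or.inr ⟨_, ⟨e, he, hve, rfl⟩, Or.inl (hins e he hve).symm⟩)
      · rintro _ ⟨e, he, rfl⟩ hf _ ⟨w, hw, rfl⟩
        have hve := mem_of_ident_mem hinj hv he hf
        -- A node sends nothing to itself; its own earlier knowledge is kept by the union in
        -- `learn`.
        by_cases hwv : w = v
        · subst hwv
          exact hKA w hv E' (fun f hf => hE' (Or.inl hf)) hE
        · refine hKA w (H.subset_vertexSet_of_mem_edgeSet he hw) E' (fun f hf => hE' ?_) hE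
          exact Or.inr ⟨_, ⟨e, he, hve, rfl⟩, Or.inr ⟨_, ⟨w, ⟨hw, hwv⟩, rfl⟩, hf⟩⟩

end LocalAlgorithm

/-! ### Maximal independent sets from minimal hitting sets -/

namespace Hypergraph

variable {V : Type u} {H : Hypergraph V}

/-- The complement of a hitting set whose nodes have private edges is a maximal independent set. -/
theorem isMIS_of_private {S : Set V} (hS : S ⊆ H.vertexSet)
    (hit : ∀ e ∈ H.edgeSet, ¬ e ⊆ S)
    (hpriv : ∀ v ∈ H.vertexSet, v ∉ S → ∃ e ∈ H.edgeSet, e \ {v} ⊆ S) : H.IsMIS S := by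
  refine ⟨⟨hS, hit⟩, fun S' hS' hle v hv => ?_⟩
  by_contra hvS
  obtain ⟨e, he, hsub⟩ := hpriv v (hS'.1 hv) hvS
  refine hS'.2 e he fun w hw => ?_
  by_cases hwv : w = v
  · exact hwv ▸ hv
  · exact hle (hsub ⟨hw, hwv⟩)

theorem incident_finite (hfin : H.vertexSet.Finite) (v : V) :
    {e | e ∈ H.edgeSet ∧ v ∈ e}.Finite :=
  hfin.finite_subsets.subset fun _ he => H.subset_vertexSet_of_mem_edgeSet he.1

/-- If no edge has more than one node, the nodes of degree zero form a maximal independent set. -/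
theorem isMIS_degree_zero (hfin : H.vertexSet.Finite) (hne : ∀ e ∈ H.edgeSet, e.Nonempty)
    (h1 : ∀ e ∈ H.edgeSet, e.ncard ≤ 1) : H.IsMIS {v | v ∈ H.vertexSet ∧ H.degree v = 0} := by
  refine isMIS_of_private (fun v hv => hv.1) (fun e he hsub => ?_) fun v hv hvS => ?_
  · obtain ⟨v, hv⟩ := hne e he
    have h := (Set.ncard_eq_zero (incident_finite hfin v)).1 (hsub hv).2
    have hmem : e ∈ {e | e ∈ H.edgeSet ∧ v ∈ e} := ⟨he, hv⟩
    rw [h] at hmem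
    exact hmem
  · have hpos : H.degree v ≠ 0 := fun h => hvS ⟨hv, h⟩
    obtain ⟨e, he, hve⟩ := Set.nonempty_of_ncard_ne_zero hpos
    refine ⟨e, he, ?_⟩
    rintro w ⟨hw, hwv⟩
    exact absurd ((Set.ncard_le_one (hfin.subset (H.subset_vertexSet_of_mem_edgeSet he))).1
      (h1 e he) w hw v hve) hwv

open LocalAlgorithm in
theorem isMIS_minimalHittingSet {ident : V → ℕ} {N Δ r : ℕ} (hfin : H.vertexSet.Finite)
    (hne : ∀ e ∈ H.edgeSet, e.Nonempty) (hΔ : ∀ v ∈ H.vertexSet, H.degree v ≤ Δ)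
    (hr : ∀ e ∈ H.edgeSet, e.ncard ≤ r) (hinj : Set.InjOn ident H.vertexSet)
    (hN : ∀ v ∈ H.vertexSet, ident v < N) :
    H.IsMIS {v | v ∈ H.vertexSet ∧
      ident v ∉ minimalHittingSet N Δ r (identEdges H ident)} := by
  have hVe : ∀ e ∈ H.edgeSet, e ⊆ H.vertexSet := fun e he => H.subset_vertexSet_of_mem_edgeSet he
  have hmem : ∀ i ∈ ⋃₀ identEdges H ident, ∃ v ∈ H.vertexSet, ident v = i := by
    rintro _ ⟨_, ⟨e, he, rfl⟩, v, hv, rfl⟩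
    exact ⟨v, hVe e he hv, rfl⟩
  have hinc : ∀ v ∈ H.vertexSet, {f | f ∈ identEdges H ident ∧ ident v ∈ f} ⊆
      (fun e => ident '' e) '' {e | e ∈ H.edgeSet ∧ v ∈ e} := by
    rintro v hv _ ⟨⟨e, he, rfl⟩, hve⟩
    exact ⟨e, ⟨he, mem_of_ident_mem hinj hv he hve⟩, rfl⟩
  obtain ⟨h1, h2⟩ := minimalHittingSet_spec (N := N) (Δ := Δ) (r := r) (E := identEdges H ident)
    (by rintro _ ⟨e, he, rfl⟩; exact (hne e he).image _)
    (by rintro _ ⟨e, he, rfl⟩; exact (hfin.subset (hVe e he)).image _)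
    (by
      rintro _ ⟨e, he, rfl⟩
      exact (Set.ncard_image_le (hfin.subset (hVe e he))).trans (hr e he))
    (by
      intro i hi
      obtain ⟨v, hv, rfl⟩ := hmem i hi
      exact ((incident_finite hfin v).image _).subset (hinc v hv))
    (by
      intro i hi
      obtain ⟨v, hv, rfl⟩ := hmem i hi
      exact (Set.ncard_le_ncard (hinc v hv) ((incident_finite hfin v).image _)).trans
        ((Set.ncard_image_le (incident_finite hfin v)).trans (hΔ v hv)))
    (by
      intro i hi
      obtain ⟨v, hv, rfl⟩ := hmem i hi
      exact hN v hv)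
  refine isMIS_of_private (fun v hv => hv.1) (fun e he hsub => ?_) fun v hv hvS => ?_
  · obtain ⟨_, ⟨v, hv, rfl⟩, hv'⟩ := h1 _ ⟨e, he, rfl⟩
    exact (hsub hv).2 hv'
  · have hvS' : ident v ∈ minimalHittingSet N Δ r (identEdges H ident) := by
      by_contra h
      exact hvS ⟨hv, h⟩
    obtain ⟨_, ⟨e, he, rfl⟩, hpriv⟩ := h2 hvS'
    refine ⟨e, he, ?_⟩
    rintro w ⟨hw, hwv⟩
    refine ⟨hVe e he hw, fun hwS => hwv (hinj (hVe e he hw) hv ?_)⟩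
    have : ident w ∈ ident '' e ∩ minimalHittingSet N Δ r (identEdges H ident) :=
      ⟨⟨w, hw, rfl⟩, hwS⟩
    rw [hpriv] at this
    exact this

end Hypergraph

/-! ### The algorithm and its round complexity -/

open Classical in
/-- The decision of a node of degree `d` with identifier `i` that knows the edges `K`. If `n ≤ 1`,
`r ≤ 1` or `Δ = 0`, the nodes of degree zero form a maximal independent set. -/
noncomputable def misOutput (c n Δ r d i : ℕ) (K : Set (Set ℕ)) : Bool :=
  if n ≤ 1 ∨ r ≤ 1 ∨ Δ = 0 then decide (d = 0)
  else decide (i ∉ minimalHittingSet (n ^ c + 1) Δ (min r n) K)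

/-- The number of rounds of the algorithm. -/
noncomputable def misRounds (c n Δ r : ℕ) : ℕ :=
  if n ≤ 1 ∨ r ≤ 1 ∨ Δ = 0 then 0 else minimalHittingSetRounds (n ^ c + 1) Δ (min r n)

theorem solvesMIS_fullInformation (c : ℕ) :
    LocalAlgorithm.SolvesMIS.{u} (LocalAlgorithm.fullInformation (misOutput c)) c
      (misRounds c) := by
  intro n Δ r V H ident hfin hn hne hΔ hr hinj hid
  -- Capping the rank at n allows log* of the rank to be charged to log* n when Δ = 1.
  have hrn : ∀ e ∈ H.edgeSet, e.ncard ≤ min r n := fun e he =>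
    le_min (hr e he)
      (hn ▸ Set.ncard_le_ncard (H.subset_vertexSet_of_mem_edgeSet he) hfin)
  have hstate := LocalAlgorithm.fullInformation_stateAfter (misOutput c) n Δ r hinj
    (misRounds c n Δ r)
  by_cases h : n ≤ 1 ∨ r ≤ 1 ∨ Δ = 0
  · have hout : {v | v ∈ H.vertexSet ∧ (LocalAlgorithm.fullInformation (misOutput c)).output
        ((LocalAlgorithm.fullInformation (misOutput c)).stateAfter n Δ r H ident
          (misRounds c n Δ r) v) = true} = {v | v ∈ H.vertexSet ∧ H.degree v = 0} := by
      ext v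
      refine and_congr_right fun hv => ?_
      obtain ⟨K, hK, -, -⟩ := hstate v hv
      rw [hK]
      simp [LocalAlgorithm.fullInformation, misOutput, if_pos h]
    rw [hout]
    refine Hypergraph.isMIS_degree_zero hfin hne fun e he => ?_
    rcases h with h | h | h
    · exact (hrn e he).trans ((min_le_right _ _).trans h)
    · exact (hr e he).trans h
    · obtain ⟨v, hv⟩ := hne e he
      have h0 := hΔ v (H.subset_vertexSet_of_mem_edgeSet he hv)
      rw [h, Nat.le_zero] at h0
      have h0' := (Set.ncard_eq_zero (Hypergraph.incident_finite hfin v)).1 h0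
      have hmem : e ∈ {e | e ∈ H.edgeSet ∧ v ∈ e} := ⟨he, hv⟩
      rw [h0'] at hmem
      exact hmem.elim
  · have hout : {v | v ∈ H.vertexSet ∧ (LocalAlgorithm.fullInformation (misOutput c)).output
        ((LocalAlgorithm.fullInformation (misOutput c)).stateAfter n Δ r H ident
          (misRounds c n Δ r) v) = true} = {v | v ∈ H.vertexSet ∧
        ident v ∉ minimalHittingSet (n ^ c + 1) Δ (min r n)
          (LocalAlgorithm.identEdges H ident)} := by
      ext v
      refine and_congr_right fun hv => ?_
      obtain ⟨K, hK, hKE, hKA⟩ := hstate v hv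
      -- The node treats the edges it knows as the whole hypergraph, which locality justifies.
      have hA := hKA K subset_rfl hKE
      rw [misRounds, if_neg h] at hA
      rw [hK, (NodeLocal.minimalHittingSet _ _ _).mem_iff hA]
      simp only [LocalAlgorithm.fullInformation, misOutput, if_neg h, decide_eq_true_eq]
    rw [hout]
    exact Hypergraph.isMIS_minimalHittingSet hfin hne hΔ hrn hinj fun v hv =>
      Nat.lt_succ_of_le (hid v hv).2

/-- The shift by `numSteps m + 4` absorbs the additive terms of the recurrence and leaves a
geometric one. -/
theorem hitRounds_add_le (d m k : ℕ) :
    hitRounds d m k + (numSteps m + 4) ≤ (numSteps m + 4) * (2 * finalColors d + 2) ^ k := by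
  induction k with
  | zero => simp [hitRounds]
  | succ k ih =>
    set Q := numSteps m + 4 with hQ
    set M := finalColors d
    calc hitRounds d m (k + 1) + Q
        ≤ (2 * M + 2) * (hitRounds d m k + Q) := by
          rw [hitRounds]
          have : 3 * M ≤ M * Q := by rw [mul_comm]; exact Nat.mul_le_mul_left M (by omega)
          nlinarith
      _ ≤ (2 * M + 2) * (Q * (2 * M + 2) ^ k) := Nat.mul_le_mul_left _ ih
      _ = Q * (2 * M + 2) ^ (k + 1) := by ring

/-- The crude summand Δ is harmless: it is later absorbed into the factor Δ ^ O(Δ). -/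
theorem logStar_finalColors_mul_le (Δ r : ℕ) (hr : 1 ≤ r) :
    logStar (finalColors (Δ * r)) ≤ logStar r + Δ + 15 := by
  have h1 : Δ * r + 1024 ≤ 2 ^ (Δ + 10) * r := by
    have : Δ < 2 ^ Δ := Nat.lt_two_pow_self
    rw [pow_add]
    nlinarith
  calc logStar (finalColors (Δ * r)) ≤ logStar (2 ^ threshold (Δ * r)) :=
        logStar_mono (finalColors_le _)
    _ ≤ logStar ((Δ * r + 1024) ^ 4) + 1 := logStar_two_pow_le _
    _ ≤ logStar (Δ * r + 1024) + 4 + 1 := by gcongr; exact logStar_pow_le _ _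
    _ ≤ logStar (2 ^ (Δ + 10) * r) + 4 + 1 := by gcongr; exact logStar_mono h1
    _ ≤ logStar r + (Δ + 10) + 4 + 1 := by gcongr; exact logStar_two_pow_mul_le _ _
    _ = _ := by ring

theorem hitRounds_le (Δ r : ℕ) (hr : 2 ≤ r) :
    hitRounds Δ (finalColors (Δ * r)) Δ ≤
      (2 * Δ + 37) * (2 * finalColors Δ + 2) ^ Δ * logStar r := by
  have h1 := hitRounds_add_le Δ (finalColors (Δ * r)) Δ
  have h2 := logStar_finalColors_mul_le Δ r (by omega)
  have h3 := one_le_logStar hr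
  -- The left side is at most 2 log* r + 2Δ + 35, and log* r ≥ 1 turns the constants into a factor.
  have h4 : numSteps (finalColors (Δ * r)) + 4 ≤ (2 * Δ + 37) * logStar r := by
    rw [numSteps]
    nlinarith
  calc hitRounds Δ (finalColors (Δ * r)) Δ
      ≤ (2 * Δ + 37) * logStar r * (2 * finalColors Δ + 2) ^ Δ :=
        (Nat.le_add_right _ _).trans (h1.trans (Nat.mul_le_mul_right _ h4))
    _ = _ := by ring

/-- For Δ ≥ 2 every factor 2 can be paid for by one more power of Δ. -/
theorem two_mul_finalColors_add_two_le {Δ : ℕ} (h : 2 ≤ Δ) : 2 * finalColors Δ + 2 ≤ Δ ^ 98 := by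
  have step : ∀ x k, x ≤ Δ ^ k → 2 * x ≤ Δ ^ (k + 1) := fun x k hx => by
    rw [pow_succ, mul_comm]
    exact Nat.mul_le_mul hx h
  have h10 : 2 ^ 10 ≤ Δ ^ 10 := Nat.pow_le_pow_left h 10
  have h1 : Δ + 1024 ≤ Δ ^ 11 := by
    rw [pow_succ]
    nlinarith
  have h2 : threshold Δ ≤ Δ ^ 44 := by
    rw [threshold, show 44 = 11 * 4 by norm_num, pow_mul]
    exact Nat.pow_le_pow_left h1 4
  have h3 : threshold Δ + 1 ≤ Δ ^ 45 := by
    have : _ ≤ Δ ^ 45 := step _ _ h2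
    have := le_threshold Δ
    omega
  have h4 : (threshold Δ + 1) * Δ ≤ Δ ^ 46 := by
    rw [pow_succ]
    exact Nat.mul_le_mul_right _ h3
  have h5 : (threshold Δ + 1) * Δ + 1 ≤ Δ ^ 47 := by
    have : _ ≤ Δ ^ 47 := step _ _ h4
    have : 1 ≤ (threshold Δ + 1) * Δ := Nat.mul_pos (by omega) (by omega)
    omega
  have h6 : finalColors Δ ≤ Δ ^ 96 := by
    rw [finalColors, show 96 = 48 * 2 by norm_num, pow_mul]
    exact Nat.pow_le_pow_left (step _ _ h5) 2
  have h7 : _ ≤ Δ ^ 98 := step _ _ (step _ _ h6)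
  have h8 : 1 ≤ finalColors Δ := Nat.one_le_pow _ _ (by omega)
  omega

theorem mul_finalColors_pow_le {Δ : ℕ} (h : 2 ≤ Δ) :
    (2 * Δ + 37) * (2 * finalColors Δ + 2) ^ Δ ≤ Δ ^ (105 * Δ) := by
  have h1 : 2 * Δ + 37 ≤ Δ ^ (7 * Δ) := by
    have h6 : 2 ^ 6 ≤ Δ ^ 6 := Nat.pow_le_pow_left h 6
    calc 2 * Δ + 37 ≤ Δ ^ 6 * Δ := by nlinarith
      _ = Δ ^ 7 := by ring
      _ ≤ Δ ^ (7 * Δ) := Nat.pow_le_pow_right (by omega) (by omega)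
  calc (2 * Δ + 37) * (2 * finalColors Δ + 2) ^ Δ
      ≤ Δ ^ (7 * Δ) * (Δ ^ 98) ^ Δ :=
        Nat.mul_le_mul h1 (Nat.pow_le_pow_left (two_mul_finalColors_add_two_le h) Δ)
    _ = Δ ^ (105 * Δ) := by rw [← pow_mul, ← pow_add]; congr 1; ring

theorem numSteps_add_one_le (c : ℕ) {n : ℕ} (hn : 2 ≤ n) :
    numSteps (n ^ c + 1) + 1 ≤ (2 * c + 6) * logStar n := by
  have h1 : logStar (n ^ c + 1) ≤ logStar n + c + 1 :=
    calc logStar (n ^ c + 1) ≤ logStar (2 ^ 1 * n ^ c) :=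
          logStar_mono (by have := Nat.one_le_pow c n (by omega); omega)
      _ ≤ logStar (n ^ c) + 1 := logStar_two_pow_mul_le _ _
      _ ≤ logStar n + c + 1 := by gcongr; exact logStar_pow_le _ _
  have h2 := one_le_logStar hn
  rw [numSteps]
  nlinarith

/-- For Δ = 1 the target has Δ log Δ = 0, leaving no free constant in front of log* r. All rounds
are then charged to log* n; hence the coefficient 0 for Δ ≤ 1. -/
theorem misRounds_le (c n Δ r : ℕ) :
    misRounds c n Δ r ≤ (if Δ ≤ 1 then 0 else Δ ^ (105 * Δ)) * logStar r +
      (2 * c + 6 + 39 * (2 * finalColors 1 + 2)) * logStar n := by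
  unfold misRounds
  split_ifs with h hΔ hΔ
  · exact Nat.zero_le _
  · exact Nat.zero_le _
  · push Not at h
    obtain rfl : Δ = 1 := by omega
    have h1 := numSteps_add_one_le c (n := n) (by omega)
    have h2 := hitRounds_le 1 (min r n) (by omega)
    have h3 : logStar (min r n) ≤ logStar n := logStar_mono (min_le_right _ _)
    have h4 := Nat.mul_le_mul_left (39 * (2 * finalColors 1 + 2)) h3
    rw [pow_one] at h2
    rw [minimalHittingSetRounds]
    linarith
  · push Not at h
    have h1 := numSteps_add_one_le c (n := n) (by omega)
    have h2 := hitRounds_le Δ (min r n) (by omega)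
    have h3 : logStar (min r n) ≤ logStar r := logStar_mono (min_le_left _ _)
    have h4 := Nat.mul_le_mul (mul_finalColors_pow_le (Δ := Δ) (by omega)) h3
    have h5 := Nat.zero_le (39 * (2 * finalColors 1 + 2) * logStar n)
    rw [minimalHittingSetRounds]
    linarith

theorem theorem3 :
    ∀ c : ℕ, 1 ≤ c →
      ∃ C : ℝ, ∃ (A : LocalAlgorithm Bool) (T : ℕ → ℕ → ℕ → ℕ),
        LocalAlgorithm.SolvesMIS.{u} A c T ∧
        ∀ n Δ r : ℕ,
          (T n Δ r : ℝ) ≤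
            (2 : ℝ) ^ (C * ((Δ : ℝ) * Real.logb 2 (Δ : ℝ))) * (logStar r : ℝ)
              + C * (logStar n : ℝ) := by
  intro c _
  -- B is the coefficient of log* n, where 39 is 2Δ + 37 at Δ = 1. Adding 105 lets one constant
  -- serve in the exponent as well.
  let B : ℕ := 2 * c + 6 + 39 * (2 * finalColors 1 + 2)
  refine ⟨((105 + B : ℕ) : ℝ), _, _, solvesMIS_fullInformation c, fun n Δ r => ?_⟩
  have h1 : ((misRounds c n Δ r : ℕ) : ℝ) ≤
      ((if Δ ≤ 1 then 0 else Δ ^ (105 * Δ) : ℕ) : ℝ) * logStar r + (B : ℝ) * logStar n := by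
    exact_mod_cast misRounds_le c n Δ r
  refine h1.trans (add_le_add (mul_le_mul_of_nonneg_right ?_ (Nat.cast_nonneg _))
    (mul_le_mul_of_nonneg_right (by exact_mod_cast Nat.le_add_left _ _) (Nat.cast_nonneg _)))
  split_ifs with h
  · rw [Nat.cast_zero]
    positivity
  · have hΔ : (1 : ℝ) ≤ Δ := by exact_mod_cast (by omega : 1 ≤ Δ)
    have h2 : (2 : ℝ) ^ (((105 + B : ℕ) : ℝ) * ((Δ : ℝ) * Real.logb 2 (Δ : ℝ))) =
        (Δ : ℝ) ^ ((105 + B) * Δ) := by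
      rw [← mul_assoc, mul_comm, Real.rpow_mul (by norm_num),
        Real.rpow_logb (by norm_num) (by norm_num) (by linarith), ← Nat.cast_mul,
        Real.rpow_natCast]
    rw [h2]
    push_cast
    exact pow_le_pow_right₀ hΔ (Nat.mul_le_mul_right _ (Nat.le_add_right _ _))
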